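/- Let $\mathbb T$ be the unit circle with normalized arc length $|d\zeta|/2\pi$. For a finite positive Borel measure $\mu$ on $\mathbb T$ and $f\in L^2(\mathbb T)$ put $$\mathcal D_\mu(f)=\int_{\mathbb T}\mathcal D_\xi(f)\,d\mu(\xi),\qquad \mathcal D_\xi(f)=\int_{\mathbb T}\Big|\frac{f(\zeta)-f(\xi)}{\zeta-\xi}\Big|^2\frac{|d\zeta|}{2\pi},$$ where $f(\xi)$ is the nontangential limit at $\xi$ of the Poisson extension of $f$, and $\mathcal D_\xi(f)=\infty$ if this limit does not exist. Let $\mathcal D^h(\mu)=\{f\in L^2(\mathbb T):\mathcal D_\mu(f)<\infty\}$ and $\|f\|_\mu^2=\|f\|_{L^2(\mathbb T)}^2+\mathcal D_\mu(f)$. For $E\subseteq\mathbb T$ define the capacity $$c_\mu(E)=\inf\{\|f\|_\mu^2 : f\in\mathcal D^h(\mu),\ |f|\ge 1\text{ a.e. on a neighbourhood of }E\}.$$ Then there is an absolute constant $C>0$ such that for every $\zeta\in\mathbb T$, every $a\in(0,1/2)$ and every Borel probability measure $\mu$ on $\mathbb T$ with $$\mu\ \ge\ \sum_{k\ge 2}\frac{a}{k^{2}}\,\delta_{\zeta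 e^{ia^k}},$$ one has $c_\mu(\{\zeta\})\ge C\sqrt a$. -/

import Mathlib

open MeasureTheory Filter Topology
open scoped ENNReal

/-- The unit circle carries its Borel σ-algebra. -/
noncomputable instance Circle.instMeasurableSpaceBorel : MeasurableSpace Circle := borel Circle

instance Circle.instBorelSpaceBorel : BorelSpace Circle := ⟨rfl⟩

namespace HarmDirichlet

/-- Normalized arc length `|dζ| / 2π` on the unit circle. -/
noncomputable def arcMeasure : Measure Circle :=
  (ENNReal.ofReal (2 * Real.pi))⁻¹ •
    (volume.restrict (Set.Ioc 0 (2 * Real.pi))).map Circle.exp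

/-- The Poisson extension of `f` to the open unit disc,
`z ↦ ∫ (1 - |z|²) / |ζ - z|² f(ζ) |dζ| / 2π`. -/
noncomputable def poissonExt (f : Circle → ℂ) (z : ℂ) : ℂ :=
  ∫ ζ : Circle, (poissonKernel 0 z (ζ : ℂ) : ℂ) * f ζ ∂arcMeasure

/-- The nontangential approach region `{z : |z| < 1, |z - ξ| < κ (1 - |z|)}` at `ξ`. -/
def approachRegion (κ : ℝ) (ξ : Circle) : Set ℂ :=
  {z : ℂ | ‖z‖ < 1 ∧ ‖z - (ξ : ℂ)‖ < κ * (1 - ‖z‖)}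

/-- `f`, identified with its Poisson extension, has nontangential limit `L` at `ξ`. -/
def HasNontangentialLimit (f : Circle → ℂ) (ξ : Circle) (L : ℂ) : Prop :=
  ∀ κ : ℝ, 1 < κ → Tendsto (poissonExt f) (𝓝[approachRegion κ ξ] (ξ : ℂ)) (𝓝 L)

open Classical in
/-- The local Dirichlet integral `D_ξ(f) = ∫ |(f(ζ) - f(ξ)) / (ζ - ξ)|² |dζ| / 2π`, where `f(ξ)` is
the nontangential limit of `f` at `ξ`; it is `∞` if that limit does not exist. -/
noncomputable def localDirichlet (f : Circle → ℂ) (ξ : Circle) : ℝ≥0∞ :=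
  if h : ∃ L : ℂ, HasNontangentialLimit f ξ L then
    ∫⁻ ζ : Circle, ‖(f ζ - h.choose) / ((ζ : ℂ) - (ξ : ℂ))‖ₑ ^ 2 ∂arcMeasure
  else ∞

/-- The weighted Dirichlet integral `D_μ(f) = ∫ D_ξ(f) dμ(ξ)`. -/
noncomputable def dirichletIntegral (μ : Measure Circle) (f : Circle → ℂ) : ℝ≥0∞ :=
  ∫⁻ ξ : Circle, localDirichlet f ξ ∂μ

/-- The harmonically weighted Dirichlet space `D^h(μ)`: all `f ∈ L²(𝕋)` with `D_μ(f) < ∞`. -/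
def dirichletSpace (μ : Measure Circle) : Set (Lp ℂ 2 arcMeasure) :=
  {f | dirichletIntegral μ f < ∞}

/-- The squared norm `‖f‖_μ² = ‖f‖²_{L²(𝕋)} + D_μ(f)`. -/
noncomputable def normSq (μ : Measure Circle) (f : Lp ℂ 2 arcMeasure) : ℝ≥0∞ :=
  ‖f‖ₑ ^ 2 + dirichletIntegral μ f

/-- The capacity `c_μ(E)`: the infimum of `‖f‖_μ²` over all `f ∈ D^h(μ)` with `|f| ≥ 1` almost
everywhere (for arc length) on a neighbourhood of `E`. -/
noncomputable def capacity (μ : Measure Circle) (E : Set Circle) : ℝ≥0∞ :=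
  sInf (normSq μ '' {f | f ∈ dirichletSpace μ ∧
    ∃ U : Set Circle, IsOpen U ∧ E ⊆ U ∧ ∀ᵐ ζ ∂arcMeasure, ζ ∈ U → 1 ≤ ‖f ζ‖})

end HarmDirichlet

namespace HarmDirichlet

/-! Let `ξ k` tend to `ζ` through the atoms and let `M` be the squared norm of `f`. An atom of mass
about `a / k²` forces the local integral at `ξ k` to be at most about `k² M / a`, which gives `f` a
value `L k` there. On a ball of radius `r`, `f` is within `r²` times that integral of `L k` in mean
square, and the ball has measure at least of order `r`. Hence neighbouring values differ by `O(k √(M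
a) a^(k/2))` (`norm_sub_sq_le`), which is summable uniformly in `a`, and `L 0` is `O(√M a^(-1/4))`
(`norm_sq_le`). Eventually `|L n| ≥ 1` (`one_le_norm_of_quotientIntegral_ne_top`), so `M` is at
least of order `√a`. -/

/-- The difference quotient integral of `f` at `ξ` with prescribed value `L` at `ξ`. -/
noncomputable def quotientIntegral (f : Circle → ℂ) (ξ : Circle) (L : ℂ) : ℝ≥0∞ :=
  ∫⁻ ζ : Circle, ‖(f ζ - L) / ((ζ : ℂ) - (ξ : ℂ))‖ₑ ^ 2 ∂arcMeasure

/-- The only use of the nontangential limit: after this, any value with finite quotient integral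
will do. -/
lemma exists_quotientIntegral_eq {f : Circle → ℂ} {ξ : Circle} (h : localDirichlet f ξ ≠ ∞) :
    ∃ L : ℂ, quotientIntegral f ξ L = localDirichlet f ξ := by
  unfold localDirichlet at h ⊢
  split_ifs at h ⊢ with hL
  · exact ⟨hL.choose, rfl⟩
  · exact absurd rfl h

/-! ### Arc length of balls. -/

lemma circle_dist_eq (ζ ξ : Circle) : dist ζ ξ = ‖(ζ : ℂ) - ξ‖ := by
  rw [← Complex.dist_eq]
  rfl

lemma dist_mul_left_circle (ζ s t : Circle) : dist (ζ * s) (ζ * t) = dist s t := by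
  rw [circle_dist_eq, circle_dist_eq, Circle.coe_mul, Circle.coe_mul, ← mul_sub, norm_mul,
    Circle.norm_coe, one_mul]

lemma dist_circle_exp_le (s t : ℝ) : dist (Circle.exp s) (Circle.exp t) ≤ |s - t| := by
  have h : ((Circle.exp s : Circle) : ℂ) - Circle.exp t
      = Circle.exp t * (Complex.exp (Complex.I * ((s - t : ℝ) : ℂ)) - 1) := by
    rw [Circle.coe_exp, Circle.coe_exp, mul_sub, ← Complex.exp_add, mul_one]
    congr 2
    push_cast
    ring
  rw [circle_dist_eq, h, norm_mul, Circle.norm_coe, one_mul]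
  exact Real.norm_exp_I_mul_ofReal_sub_one_le

lemma le_arcMeasure_closedBall (ξ : Circle) {r : ℝ} (hr : r ≤ 1) :
    ENNReal.ofReal (r / (2 * Real.pi)) ≤ arcMeasure (Metric.closedBall ξ r) := by
  have hpi := Real.pi_gt_three
  obtain ⟨t, ht, rfl⟩ : ∃ t ∈ Set.Ioc (0 : ℝ) (2 * Real.pi), Circle.exp t = ξ := by
    obtain ⟨s, hs⟩ := Circle.surjOn_exp_neg_pi_pi (Set.mem_univ ξ)
    rcases lt_or_ge 0 s with h | h
    · exact ⟨s, ⟨h, by linarith [hs.1.2]⟩, hs.2⟩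
    · exact ⟨s + 2 * Real.pi, ⟨by linarith [hs.1.1], by linarith⟩, by
        rw [Circle.exp_add, Circle.exp_two_pi, mul_one, hs.2]⟩
  -- A one-sided interval suffices; the side is chosen so that it stays in `(0, 2π]`.
  have hsub : ∃ c : ℝ, Set.Ioc c (c + r) ⊆
      Circle.exp ⁻¹' Metric.closedBall (Circle.exp t) r ∩ Set.Ioc 0 (2 * Real.pi) := by
    rcases le_total Real.pi t with h | h
    · refine ⟨t - r, fun s hs => ⟨(dist_circle_exp_le s t).trans ?_, ?_, ?_⟩⟩
      · rw [abs_le]; constructor <;> linarith [hs.1, hs.2]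
      · linarith [hs.1]
      · linarith [hs.2, ht.2]
    · refine ⟨t, fun s hs => ⟨(dist_circle_exp_le s t).trans ?_, ?_, ?_⟩⟩
      · rw [abs_le]; constructor <;> linarith [hs.1, hs.2]
      · linarith [hs.1, ht.1]
      · linarith [hs.2]
  obtain ⟨c, hc⟩ := hsub
  have hm : MeasurableSet (Metric.closedBall (Circle.exp t) r) :=
    Metric.isClosed_closedBall.measurableSet
  have hexp : Measurable Circle.exp := Circle.exp.continuous.measurable
  rw [arcMeasure, Measure.smul_apply, Measure.map_apply hexp hm,
    Measure.restrict_apply (hexp hm), smul_eq_mul, ENNReal.ofReal_div_of_pos (by positivity),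
    div_eq_mul_inv, mul_comm]
  gcongr
  refine le_trans ?_ (measure_mono hc)
  rw [Real.volume_Ioc]
  simp

lemma arcMeasure_singleton (ξ : Circle) : arcMeasure {ξ} = 0 := by
  have hc : (Circle.exp ⁻¹' {ξ}).Countable := by
    obtain ⟨t, -, rfl⟩ := Circle.surjOn_exp_neg_pi_pi (Set.mem_univ ξ)
    refine (Set.countable_range fun m : ℤ => t + m * (2 * Real.pi)).mono fun s hs => ?_
    obtain ⟨m, hm⟩ := Circle.exp_eq_exp.1 (Set.mem_singleton_iff.1 hs)
    exact ⟨m, hm.symm⟩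
  rw [arcMeasure, Measure.smul_apply, Measure.map_apply Circle.exp.continuous.measurable
    (measurableSet_singleton ξ), hc.measure_zero, smul_zero]

/-! ### Mean-square comparison of values. -/

lemma setLIntegral_sub_sq_le (f : Circle → ℂ) (ξ : Circle) (L : ℂ) {J : Set Circle}
    (hJ : MeasurableSet J) {r : ℝ} (h : ∀ ζ ∈ J, dist ζ ξ ≤ r) :
    ∫⁻ ζ in J, ‖f ζ - L‖ₑ ^ 2 ∂arcMeasure ≤
      ENNReal.ofReal (r ^ 2) * quotientIntegral f ξ L := by
  rw [quotientIntegral, ← lintegral_const_mul' _ _ ENNReal.ofReal_ne_top]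
  refine le_trans (lintegral_mono_ae ?_) (setLIntegral_le_lintegral J _)
  -- At `ξ` itself the quotient is `0` by convention, so that null point is discarded.
  have hne : ∀ᵐ ζ ∂arcMeasure.restrict J, ζ ≠ ξ :=
    ae_restrict_of_ae (measure_eq_zero_iff_ae_notMem.1 (arcMeasure_singleton ξ))
  filter_upwards [hne, ae_restrict_mem hJ] with ζ hζ hζJ
  have hd : (ζ : ℂ) - ξ ≠ 0 := sub_ne_zero.2 (fun h => hζ (Circle.ext h))
  have hr : ‖(ζ : ℂ) - ξ‖ₑ ≤ ENNReal.ofReal r := by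
    rw [← ofReal_norm, ← circle_dist_eq]
    exact ENNReal.ofReal_le_ofReal (h ζ hζJ)
  have hr0 : 0 ≤ r := dist_nonneg.trans (h ζ hζJ)
  rw [ENNReal.ofReal_pow hr0, ← mul_pow]
  refine pow_le_pow_left' ?_ 2
  calc ‖f ζ - L‖ₑ = ‖(ζ : ℂ) - ξ‖ₑ * ‖(f ζ - L) / ((ζ : ℂ) - ξ)‖ₑ := by
        rw [← enorm_mul, mul_div_cancel₀ _ hd]
    _ ≤ _ := by gcongr

/-- Two values, both close to `f` in mean square on a ball, are close to each other. -/
lemma norm_sub_sq_le_of_setLIntegral_le {f : Circle → ℂ} (hf : AEStronglyMeasurable f arcMeasure)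
    {ξ : Circle} {r A B : ℝ} (hr : r ≤ 1) (hA : 0 ≤ A) (hB : 0 ≤ B) {L L' : ℂ}
    (h : ∫⁻ ζ in Metric.closedBall ξ r, ‖f ζ - L‖ₑ ^ 2 ∂arcMeasure ≤ ENNReal.ofReal A)
    (h' : ∫⁻ ζ in Metric.closedBall ξ r, ‖f ζ - L'‖ₑ ^ 2 ∂arcMeasure ≤ ENNReal.ofReal B) :
    r / (2 * Real.pi) * ‖L - L'‖ ^ 2 ≤ 2 * (A + B) := by
  set J := Metric.closedBall ξ r
  have hm : AEMeasurable (fun ζ => ‖f ζ - L‖ₑ ^ 2) (arcMeasure.restrict J) :=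
    ((hf.restrict.sub aestronglyMeasurable_const).enorm).pow_const 2
  rw [← ENNReal.ofReal_le_ofReal_iff (by positivity), ENNReal.ofReal_mul' (by positivity)]
  calc ENNReal.ofReal (r / (2 * Real.pi)) * ENNReal.ofReal (‖L - L'‖ ^ 2)
      ≤ arcMeasure J * ENNReal.ofReal (‖L - L'‖ ^ 2) := by
        gcongr
        exact le_arcMeasure_closedBall ξ hr
    _ = ∫⁻ _ in J, ENNReal.ofReal (‖L - L'‖ ^ 2) ∂arcMeasure := by
        rw [setLIntegral_const, mul_comm]
    _ ≤ ∫⁻ ζ in J, 2 * (‖f ζ - L‖ₑ ^ 2 + ‖f ζ - L'‖ₑ ^ 2) ∂arcMeasure := by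
        refine lintegral_mono fun ζ => ?_
        have h2 : (2 : ℝ≥0∞) = ENNReal.ofReal 2 := by simp
        rw [← ofReal_norm, ← ofReal_norm, ← ENNReal.ofReal_pow (norm_nonneg _),
          ← ENNReal.ofReal_pow (norm_nonneg _), ← ENNReal.ofReal_add (by positivity)
          (by positivity), h2, ← ENNReal.ofReal_mul (by norm_num)]
        refine ENNReal.ofReal_le_ofReal ?_
        have := norm_sub_le (f ζ - L') (f ζ - L)
        rw [sub_sub_sub_cancel_left] at this
        nlinarith [norm_nonneg (L - L'), sq_nonneg (‖f ζ - L'‖ - ‖f ζ - L‖)]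
    _ = 2 * (∫⁻ ζ in J, ‖f ζ - L‖ₑ ^ 2 ∂arcMeasure
          + ∫⁻ ζ in J, ‖f ζ - L'‖ₑ ^ 2 ∂arcMeasure) := by
        rw [lintegral_const_mul' _ _ (by simp), lintegral_add_left' hm]
    _ ≤ 2 * (ENNReal.ofReal A + ENNReal.ofReal B) := by gcongr
    _ = ENNReal.ofReal (2 * (A + B)) := by
        rw [ENNReal.ofReal_mul (by norm_num), ENNReal.ofReal_add hA hB]
        simp

lemma setLIntegral_sub_sq_le_ofReal {f : Circle → ℂ} {ξ : Circle} {L : ℂ} {J : Set Circle}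
    (hJ : MeasurableSet J) {r A : ℝ} (h : ∀ ζ ∈ J, dist ζ ξ ≤ r)
    (hA : quotientIntegral f ξ L ≤ ENNReal.ofReal A) :
    ∫⁻ ζ in J, ‖f ζ - L‖ₑ ^ 2 ∂arcMeasure ≤ ENNReal.ofReal (r ^ 2 * A) := by
  refine (setLIntegral_sub_sq_le f ξ L hJ h).trans ?_
  rw [ENNReal.ofReal_mul (sq_nonneg r)]
  gcongr

/-- The `r`-ball about `ξ` lies within `2 * r` of `ξ'`. -/
lemma norm_sub_sq_le {f : Circle → ℂ} (hf : AEStronglyMeasurable f arcMeasure)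
    {ξ ξ' : Circle} {r A B : ℝ} (hr : r ≤ 1) (hA : 0 ≤ A) (hB : 0 ≤ B) {L L' : ℂ}
    (h : quotientIntegral f ξ L ≤ ENNReal.ofReal A)
    (h' : quotientIntegral f ξ' L' ≤ ENNReal.ofReal B) (hd : dist ξ ξ' ≤ r) :
    r / (2 * Real.pi) * ‖L - L'‖ ^ 2 ≤ 2 * (r ^ 2 * A + (2 * r) ^ 2 * B) := by
  have hJ := (Metric.isClosed_closedBall (x := ξ) (ε := r)).measurableSet
  refine norm_sub_sq_le_of_setLIntegral_le hf hr (by positivity) (by positivity)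
    (setLIntegral_sub_sq_le_ofReal hJ (fun ζ hζ => hζ) h)
    (setLIntegral_sub_sq_le_ofReal hJ (fun ζ hζ => ?_) h')
  rw [Metric.mem_closedBall] at hζ
  linarith [dist_triangle ζ ξ ξ']

/-- Comparison with the value `0`, where the `L²` norm replaces a quotient integral. -/
lemma norm_sq_le {f : Circle → ℂ} (hf : AEStronglyMeasurable f arcMeasure)
    {ξ : Circle} {r A M : ℝ} (hr : r ≤ 1) (hA : 0 ≤ A) (hM : 0 ≤ M) {L : ℂ}
    (h : quotientIntegral f ξ L ≤ ENNReal.ofReal A)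
    (hM' : ∫⁻ ζ, ‖f ζ‖ₑ ^ 2 ∂arcMeasure ≤ ENNReal.ofReal M) :
    r / (2 * Real.pi) * ‖L‖ ^ 2 ≤ 2 * (r ^ 2 * A + M) := by
  have hJ := (Metric.isClosed_closedBall (x := ξ) (ε := r)).measurableSet
  have := norm_sub_sq_le_of_setLIntegral_le (L' := 0) hf hr (by positivity) hM
    (setLIntegral_sub_sq_le_ofReal hJ (fun ζ hζ => hζ) h)
    ((setLIntegral_le_lintegral _ _).trans (by simpa using hM'))
  simpa using this

/-- A finite difference quotient integral forces the value at `ξ` to respect a lower bound for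
`|f|` near `ξ`. -/
lemma one_le_norm_of_quotientIntegral_ne_top {f : Circle → ℂ} {ξ : Circle} {L : ℂ}
    (h : quotientIntegral f ξ L ≠ ∞) {U : Set Circle} (hU : IsOpen U) (hξ : ξ ∈ U)
    (hf : ∀ᵐ ζ ∂arcMeasure, ζ ∈ U → 1 ≤ ‖f ζ‖) : 1 ≤ ‖L‖ := by
  by_contra! hL
  obtain ⟨ε, hε, hεU⟩ := Metric.nhds_basis_closedBall.mem_iff.1 (hU.mem_nhds hξ)
  set c := 1 - ‖L‖
  have hc : 0 < c := sub_pos.2 hL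
  set D := (quotientIntegral f ξ L).toReal
  have hD : quotientIntegral f ξ L = ENNReal.ofReal D := (ENNReal.ofReal_toReal h).symm
  have hD0 : 0 ≤ D := ENNReal.toReal_nonneg
  -- Near `ξ`, `|f - L| ≥ c` on measure of order `r`, against a mean square of at most `r² D`.
  have key : ∀ r : ℝ, 0 < r → r ≤ ε → r ≤ 1 → c ^ 2 ≤ 2 * Real.pi * D * r := by
    intro r hr hrε hr1
    have hJ := (Metric.isClosed_closedBall (x := ξ) (ε := r)).measurableSet
    have h1 := setLIntegral_sub_sq_le_ofReal hJ (fun ζ hζ => hζ) hD.le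
    have h2 : ENNReal.ofReal (c ^ 2) * arcMeasure (Metric.closedBall ξ r) ≤
        ∫⁻ ζ in Metric.closedBall ξ r, ‖f ζ - L‖ₑ ^ 2 ∂arcMeasure := by
      rw [← setLIntegral_const]
      refine lintegral_mono_ae ?_
      filter_upwards [ae_restrict_of_ae hf, ae_restrict_mem hJ] with ζ hζ hζJ
      rw [← ofReal_norm, ← ENNReal.ofReal_pow (norm_nonneg _)]
      refine ENNReal.ofReal_le_ofReal (pow_le_pow_left₀ hc.le ?_ 2)
      have := hζ (hεU (Metric.closedBall_subset_closedBall hrε hζJ))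
      linarith [norm_sub_norm_le (f ζ) L]
    have h3 : ENNReal.ofReal (c ^ 2 * (r / (2 * Real.pi))) ≤ ENNReal.ofReal (r ^ 2 * D) := by
      rw [ENNReal.ofReal_mul (sq_nonneg c)]
      refine le_trans ?_ (h2.trans h1)
      gcongr
      exact le_arcMeasure_closedBall ξ hr1
    rw [ENNReal.ofReal_le_ofReal_iff (by positivity), ← mul_div_assoc,
      div_le_iff₀ (by positivity)] at h3
    nlinarith
  have hlim : Tendsto (fun r : ℝ => 2 * Real.pi * D * r) (𝓝[>] 0) (𝓝 0) := by
    have : Tendsto (fun r : ℝ => 2 * Real.pi * D * r) (𝓝 0) (𝓝 (2 * Real.pi * D * 0)) :=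
      (continuous_const_mul _).tendsto 0
    rw [mul_zero] at this
    exact this.mono_left nhdsWithin_le_nhds
  have : c ^ 2 ≤ 0 := by
    refine ge_of_tendsto hlim ?_
    filter_upwards [Ioc_mem_nhdsGT (lt_min hε one_pos)] with r hr
    exact key r hr.1 (hr.2.trans (min_le_left _ _)) (hr.2.trans (min_le_right _ _))
  exact absurd this (not_le.2 (by positivity))

lemma mul_localDirichlet_le_dirichletIntegral {ι : Type*} {w : ι → ℝ≥0∞} {ξ : ι → Circle}
    {μ : Measure Circle} (h : Measure.sum (fun i => w i • Measure.dirac (ξ i)) ≤ μ)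
    (f : Circle → ℂ) (i : ι) : w i * localDirichlet f (ξ i) ≤ dirichletIntegral μ f := by
  rw [dirichletIntegral, ← lintegral_dirac (ξ i) (localDirichlet f), ← smul_eq_mul,
    ← lintegral_smul_measure]
  exact lintegral_mono' ((Measure.le_sum _ i).trans h) le_rfl

lemma enorm_sq_eq_lintegral (f : Lp ℂ 2 arcMeasure) :
    ‖f‖ₑ ^ 2 = ∫⁻ ζ, ‖f ζ‖ₑ ^ 2 ∂arcMeasure := by
  rw [Lp.enorm_def]
  have := eLpNorm_nnreal_pow_eq_lintegral (f := (f : Circle → ℂ)) (μ := arcMeasure)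
    (p := 2) two_ne_zero
  simpa using this

/-- A sequence with increments `O((k + 3) 2^{-k/2})` stays bounded, uniformly. -/
lemma exists_bound_of_increments : ∃ K : ℝ, 0 ≤ K ∧ ∀ (L : ℕ → ℂ) (b : ℝ), 0 ≤ b →
    (∀ k, ‖L k - L (k + 1)‖ ≤ b * ((k + 3) * √(1 / 2) ^ k)) →
    ∀ n, ‖L n‖ ≤ ‖L 0‖ + b * K := by
  set g : ℕ → ℝ := fun k => (k + 3) * √(1 / 2) ^ k
  have hs1 : ‖√(1 / 2 : ℝ)‖ < 1 := by
    rw [Real.norm_of_nonneg (Real.sqrt_nonneg _), Real.sqrt_lt' one_pos]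
    norm_num
  have hg : Summable g := by
    have h1 := summable_pow_mul_geometric_of_norm_lt_one 1 hs1
    have h2 := (summable_geometric_of_norm_lt_one hs1).mul_left 3
    refine (h1.add h2).congr fun k => ?_
    simp only [g]
    ring
  have hg0 : ∀ k, 0 ≤ g k := fun k => by positivity
  refine ⟨∑' k, g k, tsum_nonneg hg0, fun L b hb h n => ?_⟩
  have hn : ‖L n‖ ≤ ‖L 0‖ + b * ∑ k ∈ Finset.range n, g k := by
    induction n with
    | zero => simp
    | succ n ih =>
      rw [Finset.sum_range_succ, mul_add]
      have h1 := h n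
      have h2 := norm_sub_norm_le (L (n + 1)) (L n)
      rw [norm_sub_rev] at h2
      linarith
  refine hn.trans ?_
  gcongr
  exact hg.sum_le_tsum _ fun k _ => hg0 k

end HarmDirichlet

/-! ### The capacity bound. -/

open HarmDirichlet in
theorem lemma3p3 :
    ∃ C : ℝ, 0 < C ∧ ∀ (ζ : Circle) (a : ℝ), 0 < a → a < 1 / 2 →
      ∀ μ : Measure Circle, IsProbabilityMeasure μ →
        Measure.sum (fun k : {k : ℕ // 2 ≤ k} =>
          ENNReal.ofReal (a / (k : ℝ) ^ 2) • Measure.dirac (ζ * Circle.exp (a ^ (k : ℕ)))) ≤ μ →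
        ENNReal.ofReal (C * Real.sqrt a) ≤ HarmDirichlet.capacity μ {ζ} := by
  obtain ⟨K, hK, hbound⟩ := exists_bound_of_increments
  refine ⟨1 / (20 * Real.pi * (1 + K) ^ 2), by positivity, fun ζ a ha ha2 μ _ hμ => ?_⟩
  refine le_sInf ?_
  rintro _ ⟨f, ⟨hfD, U, hU, hζU, hfU⟩, rfl⟩
  have hfin : normSq μ f ≠ ∞ :=
    ENNReal.add_ne_top.2 ⟨ENNReal.pow_ne_top enorm_ne_top, ne_of_lt hfD⟩
  obtain ⟨M, hM, hMf⟩ : ∃ M : ℝ, 0 ≤ M ∧ normSq μ f = ENNReal.ofReal M :=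
    ⟨_, ENNReal.toReal_nonneg, (ENNReal.ofReal_toReal hfin).symm⟩
  set ξ : ℕ → Circle := fun k => ζ * Circle.exp (a ^ (k + 2))
  have hD : ∀ k : ℕ, localDirichlet f (ξ k) ≤ ENNReal.ofReal ((k + 2) ^ 2 * (M / a)) := by
    intro k
    have h1 := mul_localDirichlet_le_dirichletIntegral hμ f ⟨k + 2, by omega⟩
    have h2 : dirichletIntegral μ f ≤ ENNReal.ofReal M := hMf ▸ le_add_self
    have hw : 0 < a / ((k + 2 : ℕ) : ℝ) ^ 2 := by positivity
    have h3 := (ENNReal.le_div_iff_mul_le (Or.inl (ENNReal.ofReal_pos.2 hw).ne')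
      (Or.inl ENNReal.ofReal_ne_top)).2 ((mul_comm _ _).trans_le (h1.trans h2))
    rw [← ENNReal.ofReal_div_of_pos hw] at h3
    refine h3.trans_eq (congrArg _ ?_)
    push_cast
    field_simp
  choose L hL using fun k => exists_quotientIntegral_eq ((hD k).trans_lt ENNReal.ofReal_lt_top).ne
  have hLD : ∀ k : ℕ, quotientIntegral f (ξ k) (L k) ≤ ENNReal.ofReal ((k + 2) ^ 2 * (M / a)) :=
    fun k => (hL k).trans_le (hD k)
  have hf := Lp.aestronglyMeasurable f
  have hdist : ∀ k, dist (ξ k) (ξ (k + 1)) ≤ a ^ (k + 2) := by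
    intro k
    have h1 : dist (ξ k) (ξ (k + 1)) ≤ |a ^ (k + 2) - a ^ (k + 3)| :=
      (dist_mul_left_circle _ _ _).trans_le (dist_circle_exp_le _ _)
    have h2 : a ^ (k + 3) ≤ a ^ (k + 2) :=
      pow_le_pow_of_le_one ha.le (by linarith) (by omega)
    rw [abs_of_nonneg (sub_nonneg.2 h2)] at h1
    linarith [pow_pos ha (k + 3)]
  set S := √(20 * Real.pi * M)
  have hS : S ^ 2 = 20 * Real.pi * M := Real.sq_sqrt (by positivity)
  have hsa : √a ^ 2 = a := Real.sq_sqrt ha.le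
  have hsa0 : 0 < √a := Real.sqrt_pos.2 ha
  have hsa1 : √a ≤ 1 := Real.sqrt_le_one.2 (by linarith)
  have hincr : ∀ k : ℕ, ‖L k - L (k + 1)‖ ≤ S * √a * ((k + 3) * √(1 / 2) ^ k) := by
    intro k
    have hk : a ^ (k + 2) ≤ 1 := pow_le_one₀ ha.le (by linarith)
    have h1 := norm_sub_sq_le hf hk (by positivity) (by positivity) (hLD k) (hLD (k + 1))
      (hdist k)
    refine le_of_sq_le_sq ?_ (by positivity)
    -- Replacing `a` by `1 / 2` makes the bound on the increments independent of `a`.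
    have hk2 : a ^ k ≤ (1 / 2) ^ k := pow_le_pow_left₀ ha.le ha2.le k
    have hsq : (√(1 / 2 : ℝ) ^ k) ^ 2 = (1 / 2) ^ k := by
      rw [pow_right_comm, Real.sq_sqrt (by norm_num)]
    calc ‖L k - L (k + 1)‖ ^ 2
        = 2 * Real.pi / a ^ (k + 2) * (a ^ (k + 2) / (2 * Real.pi) * ‖L k - L (k + 1)‖ ^ 2) := by
          field_simp
      _ ≤ 2 * Real.pi / a ^ (k + 2) * (2 * ((a ^ (k + 2)) ^ 2 * ((k + 2) ^ 2 * (M / a)) +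
            (2 * a ^ (k + 2)) ^ 2 * (((k + 1 : ℕ) + 2) ^ 2 * (M / a)))) := by gcongr
      _ = 4 * Real.pi * M * a * a ^ k * ((k + 2) ^ 2 + 4 * (k + 3) ^ 2) := by
          push_cast
          field_simp
          ring
      _ ≤ 4 * Real.pi * M * a * (1 / 2) ^ k * ((k + 3) ^ 2 + 4 * (k + 3) ^ 2) := by
          gcongr
          norm_num
      _ = (S * √a * ((k + 3) * √(1 / 2) ^ k)) ^ 2 := by
          rw [mul_pow, mul_pow, mul_pow, hS, hsa, hsq]
          ring
  -- The radius `√a` balances `r² · 4M / a` against `M`; the total `5M` gives the `20π` in `S`.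
  have hfirst : √a * ‖L 0‖ ^ 2 ≤ S ^ 2 := by
    have hM' : ∫⁻ ζ, ‖f ζ‖ₑ ^ 2 ∂arcMeasure ≤ ENNReal.ofReal M := by
      rw [← enorm_sq_eq_lintegral, ← hMf]
      exact le_self_add
    have h1 := norm_sq_le hf hsa1 (by positivity) hM (hLD 0) hM'
    have h2 : (a * (((0 : ℕ) + 2) ^ 2 * (M / a)) : ℝ) = 4 * M := by
      push_cast
      field_simp
      ring
    rw [hsa, h2, div_mul_eq_mul_div, div_le_iff₀ (by positivity)] at h1
    rw [hS]
    linarith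
  have hev : ∃ n, 1 ≤ ‖L n‖ := by
    have ht : Tendsto ξ atTop (𝓝 ζ) := by
      have h1 : Tendsto (fun k : ℕ => a ^ (k + 2)) atTop (𝓝 0) :=
        (tendsto_pow_atTop_nhds_zero_of_lt_one ha.le (by linarith)).comp (tendsto_add_atTop_nat 2)
      have h2 := ((Circle.exp.continuous.tendsto 0).comp h1).const_mul ζ
      simpa using h2
    obtain ⟨n, hn⟩ := (ht.eventually (hU.mem_nhds (hζU rfl))).exists
    exact ⟨n, one_le_norm_of_quotientIntegral_ne_top
      ((hLD n).trans_lt ENNReal.ofReal_lt_top).ne hU hn hfU⟩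
  obtain ⟨n, hn⟩ := hev
  have hsum := hn.trans (hbound L (S * √a) (by positivity) hincr n)
  rw [hMf]
  refine ENNReal.ofReal_le_ofReal ?_
  set q := √√a
  have hq : q ^ 2 = √a := Real.sq_sqrt hsa0.le
  have hq0 : 0 ≤ q := Real.sqrt_nonneg _
  have hq1 : q ≤ 1 := Real.sqrt_le_one.2 hsa1
  have hS0 : 0 ≤ S := Real.sqrt_nonneg _
  have hqL : q * ‖L 0‖ ≤ S := le_of_sq_le_sq (by rw [mul_pow, hq]; exact hfirst) hS0
  -- Multiply `1 ≤ ‖L 0‖ + S √a K` by `q = a^(1/4)`.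
  have hqS : q ≤ S * (1 + K) := by
    have h1 : q * √a ≤ 1 := mul_le_one₀ hq1 hsa0.le hsa1
    have h2 : (q * √a) * (S * K) ≤ 1 * (S * K) := by gcongr
    have h3 := mul_le_mul_of_nonneg_left hsum hq0
    linarith
  have hfinal : √a ≤ 20 * Real.pi * M * (1 + K) ^ 2 := by
    rw [← hq, ← hS, ← mul_pow]
    exact pow_le_pow_left₀ hq0 hqS 2
  rw [one_div_mul_eq_div, div_le_iff₀ (by positivity)]
  linarith
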